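/- A tree is a finite binary tree (each node has a left and a right subtree, either possibly empty); $|T|$ is the number of nodes of $T$. The spine of a nonempty tree $T$ is the leftmost branch from its root; denote its nodes from bottom to top by $x_1,\dots,x_k$ and let $X_j$ be the right subtree of $x_j$. One step of fetch-and-discard (splay the leftmost node $x_1$ to the root and delete it) transforms $T$ as follows. If $k=1$, then $T$ is replaced by $X_1$. If $k>1$, then $x_1$ is deleted, $X_1$ becomes the left subtree of $x_2$, and for each even $j<k$ the node $x_{j+1}$ becomes the right child of $x_j$, with left subtree $X_j$ and right subtree $X_{j+1}$; the new spine is $x_2,x_4,x_6,\dots$ (from bottom to top), and if $k$ is even then $x_k$ is the new root and keeps its right subtree $X_k$. For $0\le k\le |T|$ let $\mathrm{fetch}(k,T)$ be the tree obtained from $T$ by $k$ such steps. The root persistence $\mathrm{rp}(T)$ of a tree $T$ with root $x$ is the number of $k$, $0\le k\le |T|$, such that $x$ is the root of $\mathrm{fetch}(k,T)$. Let $M_h$ be the maximal tree of height $h$, i.e. the unique binary tree with $2^{h+1}-1$ nodes whose longest path from the root to a leaf has $h$ links, and let $M_h^{[1]}$ be the tree consisting of a new root with left subtree $M_h$ and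 empty right subtree. **Corollary.** For all but finitely many $h\in\mathbb N$, $$\mathrm{rp}(M_h^{[1]})\le 8(h+3)^4 .$$ -/

import Mathlib

namespace SplayTraversal

open BinaryTree

/-- The spine (leftmost branch from the root), listed from bottom to top as
`x₁, …, x_k`, each spine node together with its right subtree `X_j`. -/
def spine {α : Type*} : BinaryTree α → List (α × BinaryTree α)
  | nil => []
  | node a l r => spine l ++ [(a, r)]

/-- `climb L [(x₂, X₂), (x₃, X₃), …]` : the spine nodes of even index stay on the spine, and each
`x_{j+1}` with `j` even is pushed off: it becomes the right child of `x_j`, with left subtree `X_j`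
and right subtree `X_{j+1}`. A topmost node of even index keeps its right subtree.
`L` is the tree which becomes the left subtree of the first node of the list. -/
def climb {α : Type*} (L : BinaryTree α) : List (α × BinaryTree α) → BinaryTree α
  | [] => L
  | [(x, X)] => node x L X
  | (x, X) :: (y, Y) :: rest => climb (node x L (node y X Y)) rest

/-- One step of fetch-and-discard: the leftmost node `x₁` is brought to the root by splaying and
is deleted; its right subtree `X₁` becomes the left subtree of `x₂`, or the whole tree if
`x₁` was the only spine node. -/
def fetchStep {α : Type*} (T : BinaryTree α) : BinaryTree α :=
  match spine T with
  | [] => nil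
  | (_, X) :: rest => climb X rest

/-- `fetch k T` is the result of `k` steps of fetch-and-discard on `T`. -/
def fetch {α : Type*} (k : ℕ) (T : BinaryTree α) : BinaryTree α :=
  fetchStep^[k] T

/-- The node at the root, if there is one. -/
def root? {α : Type*} : BinaryTree α → Option α
  | nil => none
  | node a _ _ => some a

/-- Names the nodes of a tree, in inorder, by `n, n + 1, n + 2, …`, so that different nodes
have different names. -/
def nameNodes (n : ℕ) : BinaryTree Unit → BinaryTree ℕ
  | nil => nil
  | node _ l r => node (n + l.numNodes) (nameNodes n l) (nameNodes (n + l.numNodes + 1) r)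

/-- The root persistence `rp(T)`: the number of `k` with `0 ≤ k ≤ |T|` such that the root `x` of `T`
is the root of `fetch k T`. (The empty tree has no root, and gets the value `0`.) -/
def rp (T : BinaryTree Unit) : ℕ :=
  ((Finset.range (T.numNodes + 1)).filter fun k =>
    ∃ x ∈ root? (nameNodes 0 T), x ∈ root? (fetch k (nameNodes 0 T))).card

/-- The maximal tree `M_h` of height `h` (height counted in links). -/
def maximalTree : ℕ → BinaryTree Unit
  | 0 => node () nil nil
  | h + 1 => node () (maximalTree h) (maximalTree h)

/-- The extension `A^{[k]}`: `k` times, a new root is added whose left subtree is the old tree and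
whose right subtree is empty. -/
def extend (A : BinaryTree Unit) : ℕ → BinaryTree Unit
  | 0 => A
  | k + 1 => node () (extend A k) nil

theorem numNodes_lt_two_pow_height (T : BinaryTree Unit) : T.numNodes + 1 ≤ 2 ^ T.height := by
  induction T with
  | nil => simp
  | node a l r hl hr =>
    have h1 : 2 ^ l.height ≤ 2 ^ max l.height r.height :=
      Nat.pow_le_pow_right (by norm_num) (le_max_left _ _)
    have h2 : 2 ^ r.height ≤ 2 ^ max l.height r.height :=
      Nat.pow_le_pow_right (by norm_num) (le_max_right _ _)
    simp only [numNodes, height, pow_succ]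
    omega

/-- `maximalTree h` is the one and only tree of height `h` with `2 ^ (h + 1) - 1` nodes, the largest
possible number. (`BinaryTree.height` counts nodes instead of links, hence `h + 1`.) -/
theorem eq_maximalTree_iff (h : ℕ) (T : BinaryTree Unit) :
    T = maximalTree h ↔ T.height = h + 1 ∧ T.numNodes = 2 ^ (h + 1) - 1 := by
  constructor
  · rintro rfl
    induction h with
    | zero => simp [maximalTree]
    | succ h ih =>
      obtain ⟨h1, h2⟩ := ih
      have : 0 < 2 ^ (h + 1) := by positivity
      refine ⟨by simp [maximalTree, h1], ?_⟩
      simp only [maximalTree, numNodes, h2, pow_succ 2 (h + 1)]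
      omega
  · induction h generalizing T with
    | zero =>
      rintro ⟨-, h2⟩
      cases T with
      | nil => simp at h2
      | node a l r =>
        cases l <;> cases r <;> simp_all [maximalTree]
    | succ h ih =>
      rintro ⟨h1, h2⟩
      cases T with
      | nil => simp at h1
      | node a l r =>
        simp only [height, numNodes, pow_succ 2 (h + 1)] at h1 h2
        have hp : 0 < 2 ^ (h + 1) := by positivity
        have hl := numNodes_lt_two_pow_height l
        have hr := numNodes_lt_two_pow_height r
        have hl' : l.height ≤ h + 1 := by omega
        have hr' : r.height ≤ h + 1 := by omega
        have kl : 2 ^ l.height ≤ 2 ^ (h + 1) := Nat.pow_le_pow_right (by norm_num) hl'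
        have kr : 2 ^ r.height ≤ 2 ^ (h + 1) := Nat.pow_le_pow_right (by norm_num) hr'
        have el : l.height = h + 1 := by
          refine le_antisymm hl' ((Nat.pow_le_pow_iff_right (a := 2) (by norm_num)).1 ?_)
          omega
        have er : r.height = h + 1 := by
          refine le_antisymm hr' ((Nat.pow_le_pow_iff_right (a := 2) (by norm_num)).1 ?_)
          omega
        rw [ih l ⟨el, by omega⟩, ih r ⟨er, by omega⟩]
        rfl

end SplayTraversal

/-! The new root of `M_h^{[1]}` is last in inorder, and this order survives every step, so it is the
root only when the right subtree is empty. Encode a tree by one forest per node of its rightmost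
branch: spine parities make fetch-and-discard act on the head of this list alone
(`code_fetchStep_and_headMatches`). An empty right subtree means a list of length one. Starting from
a single forest this happens at most once per outermost item, plus once (`soloCount_singleton_le`).

The forest of `M_h^{[1]}` is `maximal (h + 1)`, where `maximal (n + 1)` is `top (maximal n)`
followed by `maximal n`. Its length is therefore bounded by summing 1 + 2 `exposed (maximal n)`, and
it remains to bound `exposed` polynomially.

This is done by renormalization. On forests beginning with a mark, two rounds of `grow a` are one
round of `grow (lift a)` behind that mark (`grow_grow_mark`). So the number of rounds halves while
the discounted weights grow by a factor of at most about 7.7. This gives `exposed (maximal n)` =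
O(7.7 ^ log₂ n). Since 7.7 < 8 = 2³, summing over n stays below 8(h+3)⁴ for large h. -/

namespace SplayTraversal

open BinaryTree

/-! ### Forests encoding the future of a tree -/

/-- An ordered forest with two kinds of items, written as a list: a `mark`, or a `fork` which
carries a forest of its own; `hole` is a formal variable. A forest records how the spine length of a tree
evolves under fetch-and-discard: `mark` stands for an even length, `fork` for an odd length greater
than one, and the end of the list for length one. -/
inductive Forest
  | nil : Forest
  | mark (r : Forest) : Forest
  | fork (x r : Forest) : Forest
  | hole (r : Forest) : Forest

namespace Forest

/-- Concatenation of forests. -/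
def append : Forest → Forest → Forest
  | nil, y => y
  | mark r, y => mark (append r y)
  | fork x r, y => fork x (append r y)
  | hole r, y => hole (append r y)

/-- The effect on the code of putting a new root on top of a tree. -/
def top : Forest → Forest
  | nil => mark nil
  | mark r => fork r nil
  | fork x r => mark (append (top x) (top r))
  | hole _ => mark nil

/-- The number of items at the outermost level. -/
def length : Forest → ℕ
  | nil => 0
  | mark r => length r + 1
  | fork _ r => length r + 1
  | hole r => length r + 1

/-- The number of forks that do not come after a mark. -/
def exposed : Forest → ℕ
  | nil => 0
  | mark _ => 0
  | fork x r => 1 + exposed x + exposed r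
  | hole _ => 0

/-- Substitution of the forest `s` for the variable. -/
def subst (s : Forest) : Forest → Forest
  | nil => nil
  | mark r => mark (subst s r)
  | fork x r => fork (subst s x) (subst s r)
  | hole r => append s (subst s r)

@[simp] theorem append_nil (x : Forest) : append x nil = x := by
  induction x <;> simp_all [append]

theorem append_assoc (x y w : Forest) : append (append x y) w = append x (append y w) := by
  induction x <;> simp_all [append]

theorem subst_append (s x y : Forest) :
    subst s (append x y) = append (subst s x) (subst s y) := by
  induction x <;> simp_all [append, subst, append_assoc]

theorem subst_subst (s t x : Forest) : subst s (subst t x) = subst (subst s t) x := by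
  induction x <;> simp_all [subst, subst_append]

theorem length_append (x y : Forest) : length (append x y) = length x + length y := by
  induction x <;> simp_all [append, length] <;> omega

/-- `top` recurses through the exposed forks only: a binary recursion with e internal nodes has e +
1 leaves, and each node or leaf yields at most one item. -/
theorem length_top_le (x : Forest) : length (top x) ≤ 1 + 2 * exposed x := by
  induction x <;> simp_all [top, length, exposed, length_append]; omega

/-- When the variable is guarded by a mark, `top` commutes with substitution. -/
theorem top_subst_mark (s a : Forest) :
    top (subst (mark s) a) = subst s (top (subst (mark (hole nil)) a)) := by
  induction a with
  | nil => rfl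
  | mark r _ => simp [subst, top, subst_subst]
  | fork x r hx hr => simp [subst, top, hx, hr, subst_append]
  | hole r _ => simp [subst, top, subst_subst, append]

/-! ### Iterating `x ↦ top x ++ a[x]` -/

/-- Extend `x` by a new root, then append the pattern `a` evaluated at `x`. -/
def grow (a x : Forest) : Forest := append (top x) (subst x a)

/-- The pattern that describes two consecutive applications of `grow a`. -/
def lift (a : Forest) : Forest :=
  append (top (subst (mark (hole nil)) a))
    (subst (fork (hole nil) (subst (mark (hole nil)) a)) a)

theorem grow_mark (a s : Forest) : grow a (mark s) = fork s (subst (mark s) a) := rfl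

/-- The renormalization step: after one round every copy of s is guarded by a mark or lies inside
the new fork, so the second `top` does not look into s except through the fork's first branch. -/
theorem grow_grow_mark (a s : Forest) :
    grow a (grow a (mark s)) = mark (grow (lift a) s) := by
  rw [grow_mark]
  simp [grow, lift, top, append, subst, subst_append, subst_subst, top_subst_mark s a,
    append_assoc]

theorem iterate_grow_mark_even (a s : Forest) (j : ℕ) :
    (grow a)^[2 * j] (mark s) = mark ((grow (lift a))^[j] s) := by
  induction j with
  | zero => rfl
  | succ j ih =>
    rw [show 2 * (j + 1) = 2 * j + 1 + 1 by ring, Function.iterate_succ_apply',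
      Function.iterate_succ_apply', ih, grow_grow_mark, Function.iterate_succ_apply']

theorem iterate_grow_mark_odd (a s : Forest) (j : ℕ) :
    (grow a)^[2 * j + 1] (mark s) =
      fork ((grow (lift a))^[j] s) (subst (mark ((grow (lift a))^[j] s)) a) := by
  rw [Function.iterate_succ_apply', iterate_grow_mark_even, grow_mark]

/-! ### Weights -/

/-- The number of forks, where each preceding mark discounts by the factor `2 / 11`. -/
noncomputable def forkWeight : Forest → ℝ
  | nil => 0
  | mark r => 2 / 11 * forkWeight r
  | fork x r => 1 + forkWeight x + forkWeight r
  | hole r => forkWeight r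

/-- The number of occurrences of the variable, where each preceding mark discounts by the factor
`2 / 11`. -/
noncomputable def holeWeight : Forest → ℝ
  | nil => 0
  | mark r => 2 / 11 * holeWeight r
  | fork x r => holeWeight x + holeWeight r
  | hole r => 1 + holeWeight r

theorem forkWeight_nonneg (x : Forest) : 0 ≤ forkWeight x := by
  induction x <;> simp only [forkWeight] <;> linarith

theorem holeWeight_nonneg (x : Forest) : 0 ≤ holeWeight x := by
  induction x <;> simp only [holeWeight] <;> linarith

theorem forkWeight_append_le (x y : Forest) :
    forkWeight (append x y) ≤ forkWeight x + forkWeight y := by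
  have := forkWeight_nonneg y
  induction x <;> simp only [forkWeight, append] <;> linarith

theorem holeWeight_append_le (x y : Forest) :
    holeWeight (append x y) ≤ holeWeight x + holeWeight y := by
  have := holeWeight_nonneg y
  induction x <;> simp only [holeWeight, append] <;> linarith

theorem forkWeight_subst_le (s x : Forest) :
    forkWeight (subst s x) ≤ forkWeight x + holeWeight x * forkWeight s := by
  induction x with
  | nil => simp [forkWeight, holeWeight, subst]
  | mark r ih => simp only [forkWeight, holeWeight, subst]; linarith
  | fork x r hx hr => simp only [forkWeight, holeWeight, subst]; linarith
  | hole r ih =>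
    have := forkWeight_append_le s (subst s r)
    simp only [forkWeight, holeWeight, subst]; linarith

theorem holeWeight_subst_le (s x : Forest) :
    holeWeight (subst s x) ≤ holeWeight x * holeWeight s := by
  induction x with
  | nil => simp [holeWeight, subst]
  | mark r ih => simp only [holeWeight, subst]; linarith
  | fork x r hx hr => simp only [holeWeight, subst]; linarith
  | hole r ih =>
    have := holeWeight_append_le s (subst s r)
    simp only [holeWeight, subst]; linarith

/-- Only turning a leading mark into a fork loses the discount 2/11. At a fork, the new leading mark
compensates the losses in both branches. -/
theorem forkWeight_top_le (x : Forest) : forkWeight (top x) ≤ 1 + 11 / 2 * forkWeight x := by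
  induction x with
  | nil => simp [forkWeight, top]
  | mark r _ => simp only [forkWeight, top]; linarith
  | fork x r hx hr =>
    have := forkWeight_append_le (top x) (top r)
    have := forkWeight_nonneg x
    have := forkWeight_nonneg r
    simp only [forkWeight, top]; linarith
  | hole r _ =>
    have := forkWeight_nonneg r
    simp only [forkWeight, top]; linarith

theorem holeWeight_top_le (x : Forest) : holeWeight (top x) ≤ 11 / 2 * holeWeight x := by
  induction x with
  | nil => simp [holeWeight, top]
  | mark r _ => simp only [holeWeight, top]; linarith
  | fork x r hx hr =>
    have := holeWeight_append_le (top x) (top r)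
    have := holeWeight_nonneg x
    have := holeWeight_nonneg r
    simp only [holeWeight, top]; linarith
  | hole r _ =>
    have := holeWeight_nonneg r
    simp only [holeWeight, top]; linarith

theorem exposed_le_forkWeight (x : Forest) : (exposed x : ℝ) ≤ forkWeight x := by
  induction x with
  | nil => simp [forkWeight, exposed]
  | mark r _ => simpa [exposed] using forkWeight_nonneg (mark r)
  | fork x r hx hr => simp only [forkWeight, exposed]; push_cast; linarith
  | hole r _ => simpa [exposed] using forkWeight_nonneg (hole r)

theorem exposed_subst_mark_le (s x : Forest) :
    (exposed (subst (mark s) x) : ℝ) ≤ forkWeight x := by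
  induction x with
  | nil => simp [forkWeight, exposed, subst]
  | mark r _ => simpa [exposed, subst] using forkWeight_nonneg (mark r)
  | fork x r hx hr => simp only [forkWeight, exposed, subst]; push_cast; linarith
  | hole r _ => simpa [exposed, subst, append] using forkWeight_nonneg (hole r)

/-- A forest that does not begin with a mark. -/
def Unmarked (x : Forest) : Prop := ∀ r, x ≠ mark r

/-- After one extension an unmarked forest begins with a mark, and no weight increases. -/
theorem Unmarked.exists_top_eq {x : Forest} (hx : Unmarked x) :
    ∃ y, top x = mark y ∧ 2 / 11 * forkWeight y ≤ forkWeight x ∧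
      2 / 11 * holeWeight y ≤ holeWeight x := by
  cases x with
  | nil => exact ⟨nil, rfl, by simp [forkWeight], by simp [holeWeight]⟩
  | mark r => exact absurd rfl (hx r)
  | fork x r =>
    refine ⟨_, rfl, ?_, ?_⟩
    · have := forkWeight_append_le (top x) (top r)
      have := forkWeight_top_le x
      have := forkWeight_top_le r
      simp only [forkWeight]; linarith
    · have := holeWeight_append_le (top x) (top r)
      have := holeWeight_top_le x
      have := holeWeight_top_le r
      simp only [holeWeight]; linarith
  | hole r =>
    exact ⟨nil, rfl, by simpa [forkWeight] using forkWeight_nonneg (hole r),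
      by simpa [holeWeight] using holeWeight_nonneg (hole r)⟩

/-- The invariant of the patterns obtained by repeated lifting. -/
def Tame (a : Forest) : Prop :=
  (∃ b, a = mark b ∧ holeWeight a ≤ 1) ∨ (∃ x y, a = fork x y ∧ holeWeight a ≤ 24 / 11)

theorem Tame.holeWeight_le {a : Forest} (ha : Tame a) : holeWeight a ≤ 24 / 11 := by
  rcases ha with ⟨b, -, h⟩ | ⟨x, y, -, h⟩ <;> linarith

/-- The two kinds of tame pattern alternate under lifting. With V the hole weight and d = 2/11, a
mark pattern gives at most V + V(1 + dV) ≤ 2 + d = 24/11. A fork pattern gives at most dV(2 + dV),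
below 1 when V ≤ 24/11. The rate 15/2 is 1/d + 2. -/
theorem Tame.lift {a : Forest} (ha : Tame a) :
    Tame (lift a) ∧ forkWeight (lift a) ≤ 15 / 2 * forkWeight a + 2 := by
  have hU := forkWeight_nonneg a
  have hV := holeWeight_nonneg a
  have u1 : forkWeight (subst (mark (hole nil)) a) ≤ forkWeight a := by
    simpa [forkWeight] using forkWeight_subst_le (mark (hole nil)) a
  have v1 : holeWeight (subst (mark (hole nil)) a) ≤ 2 / 11 * holeWeight a := by
    have := holeWeight_subst_le (mark (hole nil)) a
    simp only [holeWeight] at this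
    linarith
  have u2 := forkWeight_subst_le (fork (hole nil) (subst (mark (hole nil)) a)) a
  have v2 := holeWeight_subst_le (fork (hole nil) (subst (mark (hole nil)) a)) a
  simp only [forkWeight, holeWeight] at u2 v2
  have u3 := mul_le_mul_of_nonneg_left u1 hV
  have v3 := mul_le_mul_of_nonneg_left v1 hV
  rcases ha with ⟨b, rfl, h⟩ | ⟨x, y, rfl, h⟩
  · have hb : top (subst (mark (hole nil)) (mark b)) =
        fork (subst (mark (hole nil)) b) nil := rfl
    simp only [subst, forkWeight, holeWeight] at u1 v1
    refine ⟨Or.inr ⟨subst (mark (hole nil)) b, _, rfl, ?_⟩, ?_⟩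
    · have := holeWeight_append_le (top (subst (mark (hole nil)) (mark b)))
        (subst (fork (hole nil) (subst (mark (hole nil)) (mark b))) (mark b))
      rw [hb] at this
      simp only [Forest.lift, hb]
      simp only [holeWeight] at *
      nlinarith
    · have := forkWeight_append_le (top (subst (mark (hole nil)) (mark b)))
        (subst (fork (hole nil) (subst (mark (hole nil)) (mark b))) (mark b))
      rw [hb] at this
      simp only [Forest.lift, hb]
      have h4 := mul_le_mul_of_nonneg_right h hU
      simp only [forkWeight, holeWeight] at *
      nlinarith
  · obtain ⟨w, hw, hw1, hw2⟩ :=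
      Unmarked.exists_top_eq (x := subst (mark (hole nil)) (fork x y)) (by simp [Unmarked, subst])
    refine ⟨Or.inl ⟨_, by rw [Forest.lift, hw]; rfl, ?_⟩, ?_⟩
    · have := holeWeight_append_le w
        (subst (fork (hole nil) (subst (mark (hole nil)) (fork x y))) (fork x y))
      rw [Forest.lift, hw]
      simp only [append, holeWeight] at *
      nlinarith
    · have := forkWeight_append_le w
        (subst (fork (hole nil) (subst (mark (hole nil)) (fork x y))) (fork x y))
      rw [Forest.lift, hw]
      have h4 := mul_le_mul_of_nonneg_right h hU
      simp only [append] at *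
      rw [forkWeight]
      nlinarith

theorem Unmarked.exists_grow_eq {a x : Forest} (ha : Tame a) (hx : Unmarked x) :
    ∃ q, grow a x = mark q ∧ forkWeight q ≤ 77 / 10 * forkWeight x + forkWeight a := by
  obtain ⟨w, hw, hw1, -⟩ := hx.exists_top_eq
  refine ⟨append w (subst x a), by rw [grow, hw]; rfl, ?_⟩
  have h1 := forkWeight_append_le w (subst x a)
  have h2 := forkWeight_subst_le x a
  -- The constant 77/10 rounds up 11/2 + 24/11.
  have h3 := mul_le_mul_of_nonneg_right ha.holeWeight_le (forkWeight_nonneg x)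
  have := forkWeight_nonneg x
  linarith

/-- After an even number of rounds the leading mark hides everything. After an odd number, the fork
exposes the renormalized iterate once, while the marked copies substituted into `a` stay hidden. -/
theorem exposed_iterate_grow_mark_le (a s : Forest) (m : ℕ) :
    exposed ((grow a)^[m] (mark s)) = 0 ∨ ∃ j, m = 2 * j + 1 ∧
      (exposed ((grow a)^[m] (mark s)) : ℝ) ≤
        1 + forkWeight a + exposed ((grow (lift a))^[j] s) := by
  obtain ⟨j, rfl | rfl⟩ := m.even_or_odd'
  · left; rw [iterate_grow_mark_even]; rfl
  · right
    refine ⟨j, rfl, ?_⟩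
    rw [iterate_grow_mark_odd]
    have := exposed_subst_mark_le ((grow (lift a))^[j] s) a
    simp only [exposed]; push_cast; linarith

theorem exposed_iterate_grow_le (k : ℕ) : ∀ (m : ℕ) (a x : Forest), m < 2 ^ k → Tame a →
    (exposed ((grow a)^[m] x) : ℝ) ≤
      (2 * (77 / 10) ^ k - 1) * (forkWeight x + 5 * forkWeight a + 2) := by
  induction k with
  | zero =>
    intro m a x hm _
    obtain rfl : m = 0 := by simpa using hm
    have := exposed_le_forkWeight x
    have := forkWeight_nonneg a
    simp only [Function.iterate_zero, id]
    linarith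
  | succ k ih =>
    intro m a x hm ha
    have hU := forkWeight_nonneg a
    have hx := forkWeight_nonneg x
    have hk : (1 : ℝ) ≤ (77 / 10) ^ k := one_le_pow₀ (by norm_num)
    have hG : (1 : ℝ) ≤ 2 * (77 / 10) ^ (k + 1) - 1 := by rw [pow_succ]; linarith
    have hR : 0 ≤ forkWeight x + 5 * forkWeight a + 2 := by linarith
    have step : ∀ (m' : ℕ) (q : Forest), m' ≤ m →
        forkWeight q ≤ 77 / 10 * forkWeight x + forkWeight a →
        (exposed ((grow a)^[m'] (mark q)) : ℝ) ≤
          (2 * (77 / 10) ^ (k + 1) - 1) * (forkWeight x + 5 * forkWeight a + 2) := by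
      intro m' q hm' hq
      rcases exposed_iterate_grow_mark_le a q m' with h0 | ⟨j, hj, h⟩
      · rw [h0, Nat.cast_zero]
        exact mul_nonneg (by linarith) hR
      · have hj2 : j < 2 ^ k := by rw [pow_succ] at hm; omega
        have h1 := ih j (lift a) q hj2 ha.lift.1
        -- The coefficient 5 balances exactly: 1 + 5 · 15/2 = 5 · 77/10.
        have h2 : forkWeight q + 5 * forkWeight (lift a) + 2 ≤
            77 / 10 * (forkWeight x + 5 * forkWeight a + 2) := by
          have := ha.lift.2
          linarith
        have h3 := mul_le_mul_of_nonneg_left h2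
          (show (0 : ℝ) ≤ 2 * (77 / 10) ^ k - 1 by linarith)
        -- The factor G k = 2 · 7.7 ^ k - 1 solves G (k + 1) = 7.7 · G k + 6.7; the surplus absorbs
        -- 1 + `forkWeight a`.
        have h4 : (2 * (77 / 10) ^ (k + 1) - 1) * (forkWeight x + 5 * forkWeight a + 2) =
            (2 * (77 / 10) ^ k - 1) * (77 / 10 * (forkWeight x + 5 * forkWeight a + 2)) +
              67 / 10 * (forkWeight x + 5 * forkWeight a + 2) := by
          rw [pow_succ]; ring
        linarith
    by_cases hmark : Unmarked x
    · cases m with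
      | zero =>
        have := exposed_le_forkWeight x
        have := mul_le_mul_of_nonneg_right hG hR
        simp only [Function.iterate_zero, id]
        linarith
      | succ m =>
        obtain ⟨q, hq, hq1⟩ := hmark.exists_grow_eq ha
        rw [Function.iterate_succ_apply, hq]
        exact step m q (by omega) hq1
    · simp only [Unmarked, not_forall, not_not] at hmark
      obtain ⟨q, rfl⟩ := hmark
      refine step m q le_rfl ?_
      have := forkWeight_nonneg q
      simp only [forkWeight]
      linarith

/-! ### The forests of the maximal trees -/

/-- The forests that make up the code of the maximal trees. -/
def maximal : ℕ → Forest
  | 0 => nil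
  | n + 1 => append (top (maximal n)) (maximal n)

theorem maximal_eq (n : ℕ) : maximal n = (grow (hole nil))^[n] nil := by
  induction n with
  | zero => rfl
  | succ n ih => rw [Function.iterate_succ_apply', ← ih]; simp [maximal, grow, subst]

theorem tame_lift_hole : Tame (lift (hole nil)) := by
  refine Or.inr ⟨hole nil, fork (hole nil) (mark (hole nil)), rfl, ?_⟩
  simp [lift, subst, top, append, holeWeight]
  norm_num

theorem exposed_maximal_le {n k : ℕ} (hn : n < 2 ^ (k + 1)) :
    (exposed (maximal n) : ℝ) ≤ 24 * (77 / 10) ^ k := by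
  have hk : (0 : ℝ) ≤ (77 / 10) ^ k := by positivity
  rw [maximal_eq]
  cases n with
  | zero => simpa [exposed] using hk
  | succ n =>
    rw [Function.iterate_succ_apply, show grow (hole nil) nil = mark nil from rfl]
    -- The pattern `hole nil` is not tame, but its lift is; this first halving accounts for the
    -- exponent k + 1.
    rcases exposed_iterate_grow_mark_le (hole nil) nil n with h0 | ⟨j, hj, h⟩
    · rw [h0, Nat.cast_zero]; linarith
    · have h1 := exposed_iterate_grow_le k j (lift (hole nil)) nil
        (by rw [pow_succ] at hn; omega) tame_lift_hole
      have h2 : forkWeight (lift (hole nil)) = 2 := by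
        simp [lift, subst, top, append, forkWeight]; norm_num
      simp only [h2, forkWeight] at h h1
      linarith

end Forest

/-! ### Fetch-and-discard in terms of the root -/

/-- The list omits x₁, so after an even number of entries the added top node has even index and
stays on the spine; otherwise it is pushed to the right of the node below it. -/
theorem climb_append_singleton {α : Type*} (a : α) (r : BinaryTree α) :
    ∀ (s : List (α × BinaryTree α)) (L : BinaryTree α),
      (Even s.length → climb L (s ++ [(a, r)]) = node a (climb L s) r) ∧
      (Odd s.length → ∃ x l' r', climb L s = node x l' r' ∧
        climb L (s ++ [(a, r)]) = node x l' (node a r' r))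
  | [], L => ⟨fun _ => rfl, fun h => by simp at h⟩
  | [(x, X)], L => ⟨fun h => by simp at h, fun _ => ⟨x, L, X, rfl, rfl⟩⟩
  | (x, X) :: (y, Y) :: s, L => by
    have := climb_append_singleton a r s (node x L (node y X Y))
    simpa [climb, Nat.even_add_one, Nat.odd_add_one] using this

theorem spine_ne_nil {α : Type*} (a : α) (l r : BinaryTree α) : spine (node a l r) ≠ [] := by
  simp [spine]

theorem fetchStep_node_of_odd {α : Type*} (a : α) (l r : BinaryTree α)
    (h : Odd (spine l).length) : fetchStep (node a l r) = node a (fetchStep l) r := by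
  unfold fetchStep
  rw [spine]
  cases hs : spine l with
  | nil => simp [hs] at h
  | cons p s =>
    simp only [List.cons_append]
    exact (climb_append_singleton a r s p.2).1 (by simpa [hs, Nat.odd_add_one] using h)

theorem fetchStep_node_of_even {α : Type*} (a : α) (l r : BinaryTree α) (hl : l ≠ nil)
    (h : Even (spine l).length) : ∃ x l' r', fetchStep l = node x l' r' ∧
      fetchStep (node a l r) = node x l' (node a r' r) := by
  unfold fetchStep
  rw [spine]
  cases hs : spine l with
  | nil =>
    cases l with
    | nil => exact absurd rfl hl
    | node b l r => exact absurd hs (spine_ne_nil b l r)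
  | cons p s =>
    simp only [List.cons_append]
    exact (climb_append_singleton a r s p.2).2
      (by simpa [hs, Nat.even_add_one] using h)

/-! ### The code of a tree -/

/-- Extends each forest of the list and concatenates the results. -/
def topList : List Forest → Forest
  | [] => Forest.nil
  | f :: fs => (f.top).append (topList fs)

/-- The code of a tree: one forest for each node of the rightmost branch. -/
def code {α : Type*} : BinaryTree α → List Forest
  | nil => []
  | node _ l r => topList (code l) :: code r

/-- Fetch-and-discard on codes. -/
def codeStep : List Forest → List Forest
  | [] => []
  | Forest.nil :: fs => fs
  | Forest.mark r :: fs => r :: fs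
  | Forest.fork x r :: fs => x :: r :: fs
  | Forest.hole r :: fs => r :: fs

/-- The code of a nonempty tree begins with a mark if its spine has even length, and with a fork
or an empty forest otherwise. -/
def HeadMatches : List Forest → ℕ → Prop
  | [], _ => False
  | Forest.nil :: _, n => Odd n
  | Forest.mark _ :: _, n => Even n
  | Forest.fork _ _ :: _, n => Odd n
  | Forest.hole _ :: _, _ => False

theorem code_fetchStep_and_headMatches {α : Type*} (A : BinaryTree α) :
    code (fetchStep A) = codeStep (code A) ∧
      (A ≠ nil → HeadMatches (code A) (spine A).length) := by
  induction A with
  | nil => exact ⟨rfl, fun h => absurd rfl h⟩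
  | node a l r ihl _ =>
    by_cases hl : l = nil
    · subst hl
      exact ⟨rfl, fun _ => by simp [code, topList, HeadMatches, spine]⟩
    · obtain ⟨hc, hm⟩ := ihl
      have hm := hm hl
      have hlen : (spine (node a l r)).length = (spine l).length + 1 := by simp [spine]
      rw [hlen]
      cases hcl : code l with
      | nil => simp [hcl, HeadMatches] at hm
      | cons g gs =>
        rw [hcl] at hc hm
        cases g with
        | hole y => simp [HeadMatches] at hm
        | nil =>
          rw [fetchStep_node_of_odd a l r hm]
          refine ⟨?_, fun _ => ?_⟩
          · simp [code, hc, hcl, topList, Forest.top, Forest.append, codeStep]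
          · simpa [code, hcl, topList, Forest.top, Forest.append, HeadMatches] using hm.add_one
        | fork x y =>
          rw [fetchStep_node_of_odd a l r hm]
          refine ⟨?_, fun _ => ?_⟩
          · simp [code, hc, hcl, topList, Forest.top, Forest.append, codeStep,
              Forest.append_assoc]
          · simpa [code, hcl, topList, Forest.top, Forest.append, HeadMatches] using hm.add_one
        | mark y =>
          obtain ⟨x, l', r', h1, h2⟩ := fetchStep_node_of_even a l r hl hm
          refine ⟨?_, fun _ => ?_⟩
          · rw [h1] at hc
            simp only [code, codeStep, List.cons.injEq] at hc
            simp [h2, code, hcl, hc.1, hc.2, topList, Forest.top, Forest.append, codeStep]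
          · simpa [code, hcl, topList, Forest.top, Forest.append, HeadMatches] using hm.add_one

theorem code_fetch {α : Type*} (k : ℕ) (A : BinaryTree α) :
    code (fetch k A) = codeStep^[k] (code A) := by
  induction k with
  | zero => rfl
  | succ k ih =>
    rw [fetch, Function.iterate_succ_apply', Function.iterate_succ_apply', ← ih]
    exact (code_fetchStep_and_headMatches _).1

theorem code_nameNodes (A : BinaryTree Unit) : ∀ n, code (nameNodes n A) = code A := by
  induction A with
  | nil => exact fun _ => rfl
  | node a l r hl hr => intro n; simp [nameNodes, code, hl, hr]

theorem code_maximalTree_succ (h : ℕ) :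
    code (maximalTree (h + 1)) = topList (code (maximalTree h)) :: code (maximalTree h) := rfl

theorem topList_code_maximalTree (h : ℕ) :
    topList (code (maximalTree h)) = Forest.maximal (h + 1) := by
  induction h with
  | zero => rfl
  | succ h ih => rw [code_maximalTree_succ, topList, ih]; rfl

theorem length_maximal_le (h : ℕ) :
    (Forest.maximal (h + 1)).length ≤
      ∑ n ∈ Finset.range (h + 1), (1 + 2 * (Forest.maximal n).exposed) := by
  induction h with
  | zero => simp [Forest.maximal, Forest.top, Forest.length]
  | succ h ih =>
    rw [Finset.sum_range_succ, Forest.maximal, Forest.length_append]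
    have := Forest.length_top_le (Forest.maximal (h + 1))
    omega

/-! ### Counting the times at which the code has length one -/

theorem codeStep_append {s : List Forest} (hs : s ≠ []) (t : List Forest) :
    codeStep (s ++ t) = codeStep s ++ t := by
  match s with
  | [] => exact absurd rfl hs
  | f :: fs => cases f <;> rfl

/-- The number of times before `K` at which the code has length one. -/
def soloCount (K : ℕ) (s : List Forest) : ℕ :=
  ((Finset.range K).filter fun k => (codeStep^[k] s).length = 1).card

theorem soloCount_succ (K : ℕ) (s : List Forest) :
    soloCount (K + 1) s = soloCount K (codeStep s) + if s.length = 1 then 1 else 0 := by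
  simp only [soloCount, Finset.card_filter, Finset.sum_range_succ', Function.iterate_succ_apply,
    Function.iterate_zero, id]
  rfl

theorem soloCount_nil (K : ℕ) : soloCount K [] = 0 := by
  induction K with
  | zero => rfl
  | succ K ih => rw [soloCount_succ]; simpa [codeStep] using ih

/-- Until the entries before `f` are used up the list has length at least two, so nothing is
counted. -/
theorem soloCount_append_le (f : Forest) (n : ℕ) (hf : ∀ K, soloCount K [f] ≤ n) (K : ℕ) :
    ∀ s, soloCount K (s ++ [f]) ≤ n := by
  induction K with
  | zero => intro s; simp [soloCount]
  | succ K ih =>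
    intro s
    cases s with
    | nil => exact hf _
    | cons g s =>
      rw [soloCount_succ, codeStep_append (by simp)]
      simpa using ih _

theorem soloCount_singleton_le (f : Forest) : ∀ K, soloCount K [f] ≤ f.length + 1 := by
  induction f with
  | nil =>
    rintro (_ | K)
    · simp [soloCount]
    · simp [soloCount_succ, codeStep, soloCount_nil, Forest.length]
  | mark r ih =>
    rintro (_ | K)
    · simp [soloCount]
    · have := ih K
      simp only [soloCount_succ, codeStep, Forest.length, List.length_singleton, if_true]
      omega
  | fork x r _ ih =>
    rintro (_ | K)
    · simp [soloCount]
    · have := soloCount_append_le r _ ih K [x]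
      simp only [soloCount_succ, codeStep, Forest.length, List.length_singleton, if_true]
      simp only [List.singleton_append] at this
      omega
  | hole r ih =>
    rintro (_ | K)
    · simp [soloCount]
    · have := ih K
      simp only [soloCount_succ, codeStep, Forest.length, List.length_singleton, if_true]
      omega

/-! ### The last node is at the root only if the code has length one -/

/-- The labels of a tree in inorder. -/
def inorder {α : Type*} : BinaryTree α → List α
  | nil => []
  | node a l r => inorder l ++ a :: inorder r

theorem inorder_fetchStep {α : Type*} (A : BinaryTree α) :
    inorder (fetchStep A) = (inorder A).tail := by
  induction A with
  | nil => rfl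
  | node a l r ihl _ =>
    by_cases hl : l = nil
    · subst hl; rfl
    · have hne : inorder l ≠ [] := by
        cases l with
        | nil => exact absurd rfl hl
        | node => simp [inorder]
      rcases (spine l).length.even_or_odd with h | h
      · obtain ⟨x, l', r', h1, h2⟩ := fetchStep_node_of_even a l r hl h
        rw [h1, inorder] at ihl
        rw [h2, inorder, inorder.eq_2 a l r, List.tail_append_of_ne_nil hne, ← ihl]
        simp [inorder]
      · rw [fetchStep_node_of_odd a l r h, inorder, inorder, ihl,
          List.tail_append_of_ne_nil hne]

theorem inorder_fetch {α : Type*} (k : ℕ) (A : BinaryTree α) :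
    inorder (fetch k A) = (inorder A).drop k := by
  induction k with
  | zero => rfl
  | succ k ih =>
    rw [fetch, Function.iterate_succ_apply', inorder_fetchStep]
    rw [fetch] at ih
    rw [ih, List.tail_drop]

theorem inorder_nameNodes (A : BinaryTree Unit) :
    ∀ n, inorder (nameNodes n A) = List.range' n A.numNodes := by
  induction A with
  | nil => exact fun _ => rfl
  | node a l r hl hr =>
    intro n
    simp only [nameNodes, inorder, hl, hr, numNodes]
    rw [← List.range'_succ, List.range'_append_1, Nat.add_assoc]

theorem length_code_eq_one_of_root {A : BinaryTree Unit} {k : ℕ}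
    (h : ∃ x ∈ root? (nameNodes 0 (extend A 1)),
      x ∈ root? (fetch k (nameNodes 0 (extend A 1)))) :
    (code (fetch k (nameNodes 0 (extend A 1)))).length = 1 := by
  obtain ⟨x, hx, hk⟩ := h
  have hx : x = A.numNodes := by
    simpa [extend, nameNodes, root?, eq_comm] using hx
  have hin := inorder_fetch k (nameNodes 0 (extend A 1))
  rw [inorder_nameNodes] at hin
  have hnum : (extend A 1).numNodes = A.numNodes + 1 := by simp [extend, numNodes]
  rw [hnum] at hin
  cases hB : fetch k (nameNodes 0 (extend A 1)) with
  | nil => simp [hB, root?] at hk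
  | node b l r =>
    rw [hB] at hk hin
    obtain rfl : b = x := by simpa [root?] using hk
    cases r with
    | nil => simp [code]
    | node c l' r' =>
      -- A node in the right subtree would have a name larger than that of the root, which is
      -- already the largest.
      exfalso
      have hs : (inorder (node b l (node c l' r'))).Pairwise (· < ·) := by
        rw [hin]
        exact (List.pairwise_lt_range' (s := 0) (n := A.numNodes + 1)).sublist
          (List.drop_sublist _ _)
      have hc : c ∈ inorder (node b l (node c l' r')) := by simp [inorder]
      rw [hin] at hc
      have hc := List.mem_of_mem_drop hc
      simp only [List.mem_range'_1] at hc
      rw [inorder, List.pairwise_append] at hs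
      have := (List.pairwise_cons.1 hs.2.1).1 c (by simp [inorder])
      omega

theorem rp_extend_maximalTree_le (h : ℕ) :
    rp (extend (maximalTree h) 1) ≤
      1 + ∑ n ∈ Finset.range (h + 1), (1 + 2 * (Forest.maximal n).exposed) := by
  have hcode : code (extend (maximalTree h) 1) = [Forest.maximal (h + 1)] := by
    rw [← topList_code_maximalTree]; rfl
  calc rp (extend (maximalTree h) 1)
      ≤ soloCount ((extend (maximalTree h) 1).numNodes + 1) [Forest.maximal (h + 1)] := by
        refine Finset.card_le_card fun k hk => ?_
        rw [Finset.mem_filter] at hk ⊢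
        refine ⟨hk.1, ?_⟩
        rw [← hcode, ← code_nameNodes _ 0, ← code_fetch]
        exact length_code_eq_one_of_root hk.2
    _ ≤ (Forest.maximal (h + 1)).length + 1 := soloCount_singleton_le _ _
    _ ≤ _ := by have := length_maximal_le h; omega

theorem rp_extend_maximalTree_le_of_lt {h k : ℕ} (hk : h < 2 ^ (k + 1)) :
    (rp (extend (maximalTree h) 1) : ℝ) ≤ 50 * (77 / 10) ^ k * (h + 1) := by
  have h1 : (rp (extend (maximalTree h) 1) : ℝ) ≤
      1 + ∑ n ∈ Finset.range (h + 1), (1 + 2 * ((Forest.maximal n).exposed : ℝ)) := by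
    exact_mod_cast rp_extend_maximalTree_le h
  have h2 : ∑ n ∈ Finset.range (h + 1), (1 + 2 * ((Forest.maximal n).exposed : ℝ)) ≤
      ∑ _n ∈ Finset.range (h + 1), (1 + 48 * (77 / 10 : ℝ) ^ k) := by
    refine Finset.sum_le_sum fun n hn => ?_
    have := Forest.exposed_maximal_le (n := n) (k := k) (by rw [Finset.mem_range] at hn; omega)
    linarith
  rw [Finset.sum_const, Finset.card_range, nsmul_eq_mul] at h2
  push_cast at h2
  have hp : (1 : ℝ) ≤ (77 / 10) ^ k := one_le_pow₀ (by norm_num)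
  have hh : (0 : ℝ) ≤ h := Nat.cast_nonneg h
  nlinarith [mul_le_mul_of_nonneg_left hp hh]

end SplayTraversal

theorem corollary38 :
    ∀ᶠ h : ℕ in Filter.atTop,
      SplayTraversal.rp (SplayTraversal.extend (SplayTraversal.maximalTree h) 1)
        ≤ 8 * (h + 3) ^ 4 := by
  have hlim : ∀ᶠ k : ℕ in Filter.atTop, (77 / 80 : ℝ) ^ k ≤ 8 / 50 :=
    (tendsto_pow_atTop_nhds_zero_of_lt_one (by norm_num) (by norm_num)).eventually_le_const
      (by norm_num)
  obtain ⟨K, hK⟩ := Filter.eventually_atTop.1 hlim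
  filter_upwards [Filter.eventually_ge_atTop (2 ^ K)] with h hh
  have hh0 : h ≠ 0 := by have := Nat.two_pow_pos K; omega
  set k := Nat.log 2 h
  have hk1 : 2 ^ k ≤ h := Nat.pow_log_le_self 2 hh0
  have hk2 : h < 2 ^ (k + 1) := Nat.lt_pow_succ_log_self (by norm_num) h
  have hKk : K ≤ k := Nat.le_log_of_pow_le (by norm_num) hh
  have h1 := SplayTraversal.rp_extend_maximalTree_le_of_lt hk2
  have h2 : 50 * (77 / 10 : ℝ) ^ k ≤ 8 * 8 ^ k := by
    have h3 : (77 / 10 : ℝ) ^ k = (77 / 80) ^ k * 8 ^ k := by rw [← mul_pow]; norm_num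
    have h4 := mul_le_mul_of_nonneg_right (hK k hKk) (show (0 : ℝ) ≤ 8 ^ k by positivity)
    rw [h3]; linarith
  have h5 : (8 : ℝ) ^ k ≤ (h + 3) ^ 3 := by
    calc (8 : ℝ) ^ k = (2 ^ k) ^ 3 := by rw [← pow_mul, mul_comm, pow_mul]; norm_num
      _ ≤ (h + 3) ^ 3 := by
        have : (2 : ℝ) ^ k ≤ h := by exact_mod_cast hk1
        gcongr
        linarith
  have hpos : (0 : ℝ) ≤ h := Nat.cast_nonneg h
  have h6 : (SplayTraversal.rp (SplayTraversal.extend (SplayTraversal.maximalTree h) 1) : ℝ) ≤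
      8 * (h + 3) ^ 4 := by
    calc _ ≤ 50 * (77 / 10 : ℝ) ^ k * (h + 1) := h1
      _ ≤ 8 * (h + 3) ^ 3 * (h + 3) := by
        apply mul_le_mul _ (by linarith) (by linarith) (by positivity)
        linarith
      _ = 8 * (h + 3) ^ 4 := by ring
  exact_mod_cast h6
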